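/- Let $\nu\ge 0$ and $\alpha>0$ be real. For a real- or complex-valued function $f$ on $(0,\infty)$ let $$(B_{\nu,-}^{-\alpha}f)(x)=\int_x^\infty K(x,y)\,f(y)\,dy,\qquad K(x,y)=\frac{1}{\Gamma(2\alpha)}\left(\frac{y^2-x^2}{2y}\right)^{2\alpha-1}{}_2F_1\!\left(\alpha+\frac{\nu-1}{2},\alpha;2\alpha;1-\frac{x^2}{y^2}\right)\quad(0<x<y)$$ be the right-sided fractional Bessel integral of order $\alpha$, let $$(H_\nu g)(\xi)=\int_0^\infty J_{\frac{\nu-1}{2}}(x\xi)\,x^{\frac{\nu+1}{2}}\,g(x)\,dx,\qquad \xi>0,$$ be the Hankel transform ($J$ the Bessel function of the first kind), and let $$(R_\nu^\alpha f)(\xi)=\int_0^\infty J^1_{\frac{\nu-1}{2},\alpha}(x\xi)\,x^{\frac{\nu+1}{2}}\,f(x)\,dx,\qquad J^\mu_{\gamma,\lambda}(z)=\sum_{m=0}^\infty\frac{(-1)^m}{\Gamma(\gamma+m\mu+\lambda+1)\,\Gamma(\lambda+m+1)}\left(\frac z2\right)^{2m+\gamma+2\lambda}.$$ 1. Let $\xi>0$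 and suppose that the integral of $J_{\frac{\nu-1}{2}}(x\xi)\,x^{\frac{\nu+1}{2}}K(x,y)f(y)$ over $\{0<x<y\}$ converges absolutely. Then the integral defining $(B_{\nu,-}^{-\alpha}f)(x)$ converges absolutely for almost every $x>0$, the integrals defining $(H_\nu B_{\nu,-}^{-\alpha}f)(\xi)$ and $(R_\nu^\alpha f)(\xi)$ converge absolutely, and $$(H_\nu B_{\nu,-}^{-\alpha}f)(\xi)=\xi^{-2\alpha}\,(R_\nu^\alpha f)(\xi).$$ 2. If $f$ is measurable and $\int_0^\infty y^{2\alpha+\nu}|f(y)|\,dy<\infty$, then the condition in 1 is satisfied for every $\xi>0$, so the formula holds for every $\xi>0$. If moreover $f$ is continuous on $(0,\infty)$, then the integral defining $(B_{\nu,-}^{-\alpha}f)(x)$ converges absolutely for every $x>0$. -/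

import Mathlib

open MeasureTheory Set

/-- The Bessel function of the first kind `J_γ(z)`, for a real order `γ` and a real argument `z > 0`:
`∑ (-1)^m / (m! Γ(γ + m + 1)) (z / 2)^(2 m + γ)`. (Since `Real.Gamma` vanishes at its poles, the
reciprocal of Gamma is `0` there, as it should be.) -/
noncomputable def besselJ (γ z : ℝ) : ℝ :=
  ∑' m : ℕ, (-1) ^ m / ((m.factorial : ℝ) * Real.Gamma (γ + m + 1)) * (z / 2) ^ (2 * (m : ℝ) + γ)

/-- The Wright (generalized Mittag-Leffler) function `J^μ_{γ,l}(z)`, for real `z > 0`: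
`∑ (-1)^m / (Γ(γ + m μ + l + 1) Γ(l + m + 1)) (z / 2)^(2 m + γ + 2 l)`. -/
noncomputable def wrightJ (μ γ l z : ℝ) : ℝ :=
  ∑' m : ℕ, (-1) ^ m / (Real.Gamma (γ + m * μ + l + 1) * Real.Gamma (l + m + 1)) *
    (z / 2) ^ (2 * (m : ℝ) + γ + 2 * l)

/-- The kernel of the right-sided fractional Bessel integral on the half-line, for `0 < x < y`. The
argument of the Gauss hypergeometric function lies in `(0, 1)`, where its series converges. -/
noncomputable def besselKernel (ν α x y : ℝ) : ℝ :=
  1 / Real.Gamma (2 * α) * ((y ^ 2 - x ^ 2) / (2 * y)) ^ (2 * α - 1) *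
    ordinaryHypergeometric (α + (ν - 1) / 2) α (2 * α) (1 - x ^ 2 / y ^ 2)

/-- The right-sided fractional Bessel integral `B_{ν,-}^{-α} f`, that is, the fractional power of
order `-α` of the Bessel operator `D² + (ν / x) D` on `(0, ∞)`. -/
noncomputable def fracBesselMinus {𝕜 : Type*} [RCLike 𝕜] (ν α : ℝ) (f : ℝ → 𝕜) (x : ℝ) : 𝕜 :=
  ∫ y in Ioi x, besselKernel ν α x y • f y

/-- The kernel of the Hankel transform. -/
noncomputable def hankelKernel (ν ξ x : ℝ) : ℝ :=
  besselJ ((ν - 1) / 2) (x * ξ) * x ^ ((ν + 1) / 2)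

/-- The Hankel transform `H_ν`. -/
noncomputable def hankelTransform {𝕜 : Type*} [RCLike 𝕜] (ν : ℝ) (f : ℝ → 𝕜) (ξ : ℝ) : 𝕜 :=
  ∫ x in Ioi (0 : ℝ), hankelKernel ν ξ x • f x

/-- The kernel of the transform `R_ν^α`. -/
noncomputable def wrightKernel (ν α ξ x : ℝ) : ℝ :=
  wrightJ 1 ((ν - 1) / 2) α (x * ξ) * x ^ ((ν + 1) / 2)

/-- The integral transform `R_ν^α` with Wright function kernel. -/
noncomputable def wrightTransform {𝕜 : Type*} [RCLike 𝕜] (ν α : ℝ) (f : ℝ → 𝕜) (ξ : ℝ) : 𝕜 :=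
  ∫ x in Ioi (0 : ℝ), wrightKernel ν α ξ x • f x

/-- The repeated integral over `0 < x < y < ∞` that defines `(H_ν B_{ν,-}^{-α} f)(ξ)` converges
absolutely. -/
def HankelBesselConverges {𝕜 : Type*} [RCLike 𝕜] (ν α ξ : ℝ) (f : ℝ → 𝕜) : Prop :=
  IntegrableOn (fun p : ℝ × ℝ => (hankelKernel ν ξ p.1 * besselKernel ν α p.1 p.2) • f p.2)
    {p : ℝ × ℝ | 0 < p.1 ∧ p.1 < p.2}

/-! The formula is Fubini on the triangle `0 < x < y` combined with the Hankel transform of the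
kernel in `x` (`integral_hankelKernel_mul_besselKernel`). Expand the Hankel kernel as `x ^ ν` times
a power series in `x ^ 2`. Each term is a moment of `besselKernel`, which the substitution `t = 1 -
x² / y²` turns into a beta-weighted integral of the hypergeometric function. Termwise integration of
that series gives a hypergeometric series at `1`, and Gauss' theorem sums it into Gamma factors.
These cancel the Bessel coefficients and leave the Wright coefficients. Almost everywhere
convergence follows from Fubini after dividing by the Hankel kernel, whose zeros are negligible by
analyticity. For the sufficient condition, an energy argument bounds the Hankel kernel by a multiple
of `x ^ ν`, and homogeneity gives `∫ x ^ ν |K(x, y)| dx = C y ^ (2α + ν)`, so Tonelli applies.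
Convergence at every `x` for continuous `f` rests on a pointwise kernel bound, used separately near
`y = x` and for `y > 2x`. -/

open Filter Topology

/-! ### Rising factorials, the binomial series and beta integrals. -/

/-- The rising factorial `a (a + 1) ⋯ (a + n - 1)` of a real number. -/
noncomputable def poch (a : ℝ) (n : ℕ) : ℝ := (ascPochhammer ℝ n).eval a

@[simp] theorem poch_zero (a : ℝ) : poch a 0 = 1 := by simp [poch]

theorem poch_succ (a : ℝ) (n : ℕ) : poch a (n + 1) = poch a n * (a + n) :=
  ascPochhammer_succ_eval n a

theorem poch_pos {a : ℝ} (ha : 0 < a) (n : ℕ) : 0 < poch a n := ascPochhammer_pos n a ha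

theorem poch_nonneg {a : ℝ} (ha : 0 ≤ a) (n : ℕ) : 0 ≤ poch a n := by
  induction n with
  | zero => simp
  | succ n ih => rw [poch_succ]; positivity

theorem abs_poch_le (a : ℝ) (n : ℕ) : |poch a n| ≤ poch |a| n := by
  induction n with
  | zero => simp
  | succ n ih =>
    rw [poch_succ, poch_succ, abs_mul]
    refine mul_le_mul ih ?_ (abs_nonneg _) (poch_nonneg (abs_nonneg a) n)
    exact (abs_add_le _ _).trans (by simp)

theorem Real.Gamma_add_natCast {z : ℝ} (hz : 0 < z) (n : ℕ) :
    Real.Gamma (z + n) = Real.Gamma z * poch z n := by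
  induction n with
  | zero => simp
  | succ n ih =>
    have h : z + n ≠ 0 := by positivity
    rw [Nat.cast_succ, ← add_assoc, Real.Gamma_add_one h, ih, poch_succ]
    ring

/-- The binomial series. -/
theorem hasSum_poch_div_factorial_mul_pow (q : ℝ) {t : ℝ} (ht : |t| < 1) :
    HasSum (fun n : ℕ => poch q n / n.factorial * t ^ n) ((1 - t) ^ (-q)) := by
  have h := (Real.one_div_one_sub_rpow_hasFPowerSeriesOnBall_zero q).hasSum (y := t)
    (by simpa [enorm_eq_nnnorm, ← NNReal.coe_lt_coe] using! ht)
  have h0 : 0 ≤ 1 - t := by have := (abs_lt.1 ht).2; linarith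
  rw [Real.rpow_neg h0, ← one_div]
  have hc : ∀ n : ℕ, Ring.choose (q + n - 1) n = poch q n / n.factorial := fun n => by
    have h1 := Ring.factorial_nsmul_multichoose_eq_ascPochhammer q n
    rw [Polynomial.ascPochhammer_smeval_eq_eval, nsmul_eq_mul] at h1
    have h2 : Ring.choose (q + n - 1) n = Ring.multichoose q n := by
      rw [Ring.choose]; congr 1; ring
    have h3 : (n.factorial : ℝ) ≠ 0 := by positivity
    rw [h2, poch, ← h1]
    field_simp
  simpa [FormalMultilinearSeries.ofScalars_apply_eq, hc, mul_comm] using h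

theorem integrableOn_betaWeight {u v : ℝ} (hu : 0 < u) (hv : 0 < v) :
    IntegrableOn (fun t : ℝ => t ^ (u - 1) * (1 - t) ^ (v - 1)) (Ioo 0 1) := by
  have h := Complex.betaIntegral_convergent (u := u) (v := v) (by simpa) (by simpa)
  rw [intervalIntegrable_iff_integrableOn_Ioo_of_le (by simp)] at h
  refine IntegrableOn.congr_fun (f := fun x : ℝ => RCLike.re
    ((x : ℂ) ^ ((u : ℂ) - 1) * (1 - (x : ℂ)) ^ ((v : ℂ) - 1))) h.re (fun x hx => ?_) measurableSet_Ioo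
  simp only
  norm_cast
  rw [← Complex.ofReal_cpow hx.1.le, ← Complex.ofReal_cpow (by linarith [hx.2]), RCLike.re_to_complex,
    Complex.re_mul_ofReal, Complex.ofReal_re]

theorem integral_betaWeight {u v : ℝ} (hu : 0 < u) (hv : 0 < v) :
    ∫ t in Ioo (0 : ℝ) 1, t ^ (u - 1) * (1 - t) ^ (v - 1) =
      Real.Gamma u * Real.Gamma v / Real.Gamma (u + v) := by
  have h := Complex.betaIntegral_convergent (u := u) (v := v) (by simpa) (by simpa)
  rw [intervalIntegrable_iff_integrableOn_Ioc_of_le (by simp)] at h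
  change _ = ProbabilityTheory.beta u v
  rw [ProbabilityTheory.beta_eq_betaIntegralReal u v hu hv, Complex.betaIntegral,
    intervalIntegral.integral_of_le (by norm_num), ← integral_Ioc_eq_integral_Ioo,
    ← RCLike.re_to_complex, ← integral_re h]
  refine setIntegral_congr_fun measurableSet_Ioc fun x hx => ?_
  norm_cast
  rw [← Complex.ofReal_cpow hx.1.le, ← Complex.ofReal_cpow (by linarith [hx.2]), RCLike.re_to_complex,
    Complex.re_mul_ofReal, Complex.ofReal_re]

/-- Termwise integration of a power series, dominated by a binomial series, against the weight of
the beta integral. -/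
theorem powerSeries_betaWeight {d : ℕ → ℝ} {F : ℝ → ℝ} {C q u v : ℝ} (hq : 0 ≤ q)
    (hd : ∀ n, |d n| ≤ C * (poch q n / n.factorial)) (hu : 0 < u) (hv : q < v)
    (hF : ∀ t ∈ Ioo (0 : ℝ) 1, HasSum (fun n => d n * t ^ n) (F t)) :
    IntegrableOn (fun t => F t * (t ^ (u - 1) * (1 - t) ^ (v - 1))) (Ioo 0 1) ∧
    HasSum (fun n : ℕ => d n * (Real.Gamma (u + n) * Real.Gamma v / Real.Gamma (u + n + v)))
      (∫ t in Ioo (0 : ℝ) 1, F t * (t ^ (u - 1) * (1 - t) ^ (v - 1))) := by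
  set w : ℝ → ℝ := fun t => t ^ (u - 1) * (1 - t) ^ (v - 1) with hw
  have hwm : Measurable w := by fun_prop
  have hw0 : ∀ t ∈ Ioo (0 : ℝ) 1, 0 ≤ w t := fun t ht =>
    mul_nonneg (Real.rpow_nonneg ht.1.le _) (Real.rpow_nonneg (by linarith [ht.2]) _)
  -- The dominating series sums to a beta weight with exponent `v - q - 1` at `1`, integrable
  -- because `q < v`.
  have hbs : ∀ t ∈ Ioo (0 : ℝ) 1,
      HasSum (fun n : ℕ => C * (poch q n / n.factorial) * t ^ n * w t)
        (C * (t ^ (u - 1) * (1 - t) ^ (v - q - 1))) := fun t ht => by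
    have h := ((hasSum_poch_div_factorial_mul_pow q
      (t := t) (abs_lt.2 ⟨by linarith [ht.1], ht.2⟩)).mul_left C).mul_right (w t)
    have h1 : 0 < 1 - t := by linarith [ht.2]
    convert! h using 1
    · funext n; ring
    · simp only [hw]
      rw [show v - q - 1 = -q + (v - 1) by ring, Real.rpow_add h1]
      ring
  have hbi : IntegrableOn (fun t : ℝ => C * (t ^ (u - 1) * (1 - t) ^ (v - q - 1))) (Ioo 0 1) :=
    (integrableOn_betaWeight hu (by linarith)).const_mul C
  have hle : ∀ n : ℕ, ∀ t ∈ Ioo (0 : ℝ) 1,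
      ‖d n * t ^ n * w t‖ ≤ C * (poch q n / n.factorial) * t ^ n * w t := fun n t ht => by
    rw [norm_mul, norm_mul, Real.norm_of_nonneg (hw0 t ht), Real.norm_of_nonneg (pow_nonneg ht.1.le n)]
    have := pow_nonneg ht.1.le n
    have := hw0 t ht
    gcongr
    exact hd n
  have hsum : ∀ t ∈ Ioo (0 : ℝ) 1, HasSum (fun n => d n * t ^ n * w t) (F t * w t) :=
    fun t ht => (hF t ht).mul_right _
  constructor
  · refine Integrable.mono' hbi ?_ ((ae_restrict_iff' measurableSet_Ioo).2 (ae_of_all _ ?_))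
    · refine aestronglyMeasurable_of_tendsto_ae (u := atTop)
        (f := fun N t => ∑ n ∈ Finset.range N, d n * t ^ n * w t) (fun N => ?_)
        ((ae_restrict_iff' measurableSet_Ioo).2 (ae_of_all _ fun t ht =>
          (hsum t ht).tendsto_sum_nat))
      exact Measurable.aestronglyMeasurable (by fun_prop)
    · intro t ht
      have h1 := (hbs t ht)
      rw [← (hsum t ht).tsum_eq, ← h1.tsum_eq]
      exact tsum_of_norm_bounded h1.summable.hasSum (fun n => hle n t ht)
  · have h := hasSum_integral_of_dominated_convergence (μ := volume.restrict (Ioo (0 : ℝ) 1))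
      (F := fun n t => d n * t ^ n * w t) (f := fun t => F t * w t)
      (fun n t => C * (poch q n / n.factorial) * t ^ n * w t)
      (fun n => Measurable.aestronglyMeasurable (by fun_prop))
      (fun n => (ae_restrict_iff' measurableSet_Ioo).2 (ae_of_all _ (hle n)))
      ((ae_restrict_iff' measurableSet_Ioo).2 (ae_of_all _ fun t ht => (hbs t ht).summable))
      (hbi.congr_fun (fun t ht => (hbs t ht).tsum_eq.symm) measurableSet_Ioo)
      ((ae_restrict_iff' measurableSet_Ioo).2 (ae_of_all _ hsum))
    convert! h using 2 with n
    have hun : 0 < u + n := by positivity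
    rw [← integral_betaWeight hun (hq.trans_lt hv), ← integral_const_mul]
    refine setIntegral_congr_fun measurableSet_Ioo fun t ht => ?_
    simp only [hw]
    rw [show u + n - 1 = n + (u - 1) by ring, Real.rpow_add ht.1, Real.rpow_natCast]
    ring

/-! ### The Gauss hypergeometric series. -/

/-- The coefficients of the Gauss hypergeometric series. -/
noncomputable def hypCoeff (a b c : ℝ) (n : ℕ) : ℝ :=
  poch a n * poch b n / (poch c n * n.factorial)

theorem ordinaryHypergeometric_eq_tsum_hypCoeff (a b c t : ℝ) :
    ordinaryHypergeometric a b c t = ∑' n, hypCoeff a b c n * t ^ n := by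
  rw [ordinaryHypergeometric_eq_tsum]
  refine tsum_congr fun n => ?_
  simp only [hypCoeff, poch, smul_eq_mul, div_eq_mul_inv, mul_inv]
  ring

/-- Gauss' summation theorem. -/
theorem hasSum_hypCoeff {a b c : ℝ} (hb : 0 < b) (hc : b + |a| < c) :
    HasSum (hypCoeff a b c)
      (Real.Gamma c * Real.Gamma (c - a - b) / (Real.Gamma (c - a) * Real.Gamma (c - b))) := by
  have ha := abs_nonneg a
  have ha' := le_abs_self a
  have hab : 0 < c - a - b := by linarith
  have hc0 : 0 < c := by linarith
  have hcb : 0 < c - b := by linarith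
  -- Euler's integral at argument `1`: integrating the binomial series of `(1 - t) ^ (-a)` termwise
  -- produces the hypergeometric series, while the closed form is again a beta integral. Since `a`
  -- may be negative, the dominating exponent is `|a|`.
  have h := (powerSeries_betaWeight (d := fun n => poch a n / n.factorial)
    (F := fun t => (1 - t) ^ (-a)) (C := 1) (q := |a|) (u := b) (v := c - b) ha
    (fun n => by
      rw [abs_div, one_mul, Nat.abs_cast]
      gcongr
      exact abs_poch_le a n) hb (by linarith)
    (fun t ht => hasSum_poch_div_factorial_mul_pow a (abs_lt.2 ⟨by linarith [ht.1], ht.2⟩))).2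
  have hG := (Real.Gamma_pos_of_pos hc0).ne'
  have hGb := (Real.Gamma_pos_of_pos hb).ne'
  have hGcb := (Real.Gamma_pos_of_pos hcb).ne'
  have hI : ∫ t in Ioo (0 : ℝ) 1, (1 - t) ^ (-a) * (t ^ (b - 1) * (1 - t) ^ (c - b - 1)) =
      Real.Gamma b * Real.Gamma (c - a - b) / Real.Gamma (c - a) := by
    have e := integral_betaWeight hb hab
    rw [show b + (c - a - b) = c - a by ring] at e
    rw [← e]
    refine setIntegral_congr_fun measurableSet_Ioo fun t ht => ?_
    have h1 : 0 < 1 - t := by linarith [ht.2]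
    rw [show c - a - b - 1 = -a + (c - b - 1) by ring, Real.rpow_add h1]
    ring
  rw [hI] at h
  convert! h.mul_right (Real.Gamma c / (Real.Gamma b * Real.Gamma (c - b))) using 1
  · funext n
    have hp := (poch_pos hc0 n).ne'
    rw [show b + n + (c - b) = c + n by ring, Real.Gamma_add_natCast hb, Real.Gamma_add_natCast hc0,
      hypCoeff]
    field_simp
  · have := (Real.Gamma_pos_of_pos (by linarith : 0 < c - a)).ne'
    field_simp

/-- Comparison of the hypergeometric coefficients with those of a binomial series. -/
theorem exists_abs_hypCoeff_le {a b c q : ℝ} (hb : 0 < b) (hc : 0 < c) (hq : 0 < q)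
    (h : a + b < q + c) :
    ∃ C, 0 ≤ C ∧ ∀ n, |hypCoeff a b c n| ≤ C * (poch q n / n.factorial) := by
  -- Comparison of consecutive ratios. The `n²` terms cancel, so the inequality is affine in `n`
  -- once `n ≥ -a` removes the absolute value, and `a + b < q + c` makes it hold eventually.
  obtain ⟨N, hN⟩ : ∃ N : ℕ, ∀ n : ℕ, N ≤ n → |a + n| * (b + n) ≤ (q + n) * (c + n) := by
    obtain ⟨N, hN⟩ := exists_nat_ge (max (-a) ((a * b - q * c) / (q + c - a - b)))
    refine ⟨N, fun n hn => ?_⟩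
    have hn' : (N : ℝ) ≤ n := by exact_mod_cast hn
    have h1 := (le_max_left _ _).trans (hN.trans hn')
    have h2 := (le_max_right _ _).trans (hN.trans hn')
    rw [div_le_iff₀ (by linarith)] at h2
    rw [abs_of_nonneg (by linarith)]
    nlinarith
  have hv : ∀ n, 0 < poch q n / n.factorial := fun n => by
    have := poch_pos hq n
    positivity
  set r : ℕ → ℝ := fun n => |hypCoeff a b c n| / (poch q n / n.factorial) with hr
  have hr0 : ∀ n, 0 ≤ r n := fun n => div_nonneg (abs_nonneg _) (hv n).le
  have hstep : ∀ n, N ≤ n → r (n + 1) ≤ r n := fun n hn => by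
    have hpc := poch_pos hc n
    have hpb := poch_pos hb n
    have hpq := poch_pos hq n
    have hcn : 0 < c + n := by positivity
    have hbn : 0 < b + n := by positivity
    have hqn : 0 < q + n := by positivity
    have e : r (n + 1) = r n * (|a + n| * (b + n) / ((q + n) * (c + n))) := by
      simp only [hr, hypCoeff, poch_succ, abs_div, abs_mul, Nat.abs_cast, abs_of_pos hpc,
        abs_of_pos hpb, abs_of_pos hcn, abs_of_pos hbn, Nat.factorial_succ]
      push_cast
      field_simp
    rw [e]
    refine mul_le_of_le_one_right (hr0 n) ?_
    rw [div_le_one (by positivity)]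
    exact hN n hn
  -- The quotient `r` decreases from `N` on; the sum of its first values majorizes their maximum.
  refine ⟨∑ k ∈ Finset.range (N + 1), r k, Finset.sum_nonneg fun k _ => hr0 k, fun n => ?_⟩
  rw [← div_le_iff₀ (hv n)]
  change r n ≤ _
  have hs : ∀ k ≤ N, r k ≤ ∑ k ∈ Finset.range (N + 1), r k := fun k hk =>
    Finset.single_le_sum (fun i _ => hr0 i) (Finset.mem_range.2 (by omega))
  rcases le_total n N with hn | hn
  · exact hs n hn
  · refine le_trans ?_ (hs N le_rfl)
    induction n, hn using Nat.le_induction with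
    | base => exact le_rfl
    | succ n hn ih => exact (hstep n hn).trans ih

theorem hasSum_ordinaryHypergeometric {a b c t : ℝ} (hb : 0 < b) (hc : 0 < c) (ht : |t| < 1) :
    HasSum (fun n => hypCoeff a b c n * t ^ n) (ordinaryHypergeometric a b c t) := by
  obtain ⟨C, -, hC⟩ := exists_abs_hypCoeff_le (a := a) (q := |a| + b) hb hc
    (by positivity) (by linarith [le_abs_self a])
  rw [ordinaryHypergeometric_eq_tsum_hypCoeff]
  refine Summable.hasSum (Summable.of_norm_bounded
    (g := fun n : ℕ => C * (poch (|a| + b) n / n.factorial * |t| ^ n))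
    ((hasSum_poch_div_factorial_mul_pow _ (by rwa [abs_abs])).summable.mul_left C) fun n => ?_)
  rw [norm_mul, norm_pow, ← mul_assoc]
  exact mul_le_mul_of_nonneg_right (hC n) (by positivity)

theorem exists_abs_ordinaryHypergeometric_le {a b c q : ℝ} (hb : 0 < b) (hc : 0 < c) (hq : 0 < q)
    (h : a + b < q + c) :
    ∃ C, 0 ≤ C ∧ ∀ t ∈ Ico (0 : ℝ) 1, |ordinaryHypergeometric a b c t| ≤ C * (1 - t) ^ (-q) := by
  obtain ⟨C, hC0, hC⟩ := exists_abs_hypCoeff_le hb hc hq h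
  refine ⟨C, hC0, fun t ht => ?_⟩
  have ht' : |t| < 1 := abs_lt.2 ⟨by linarith [ht.1], ht.2⟩
  rw [ordinaryHypergeometric_eq_tsum_hypCoeff]
  rw [← Real.norm_eq_abs]
  refine tsum_of_norm_bounded ((hasSum_poch_div_factorial_mul_pow q ht').mul_left C) fun n => ?_
  rw [norm_mul, norm_pow, Real.norm_of_nonneg ht.1, ← mul_assoc]
  exact mul_le_mul_of_nonneg_right (hC n) (pow_nonneg ht.1 n)

theorem continuousOn_ordinaryHypergeometric {a b c : ℝ} (hb : 0 < b) (hc : 0 < c) :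
    ContinuousOn (ordinaryHypergeometric a b c : ℝ → ℝ) (Ioo 0 1) := by
  intro t ht
  obtain ⟨r, htr, hr⟩ := exists_between ht.2
  have hr0 : 0 < r := ht.1.trans htr
  have hs := (hasSum_ordinaryHypergeometric (a := a) hb hc
    (abs_lt.2 ⟨by linarith, hr⟩ : |r| < 1)).summable.norm
  have h : ContinuousOn (fun t => ∑' n, hypCoeff a b c n * t ^ n) (Ioo 0 r) := by
    refine continuousOn_tsum (fun n => by fun_prop) hs fun n x hx => ?_
    rw [norm_mul, norm_mul, norm_pow, norm_pow, Real.norm_of_nonneg hx.1.le,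
      Real.norm_of_nonneg hr0.le]
    have := hx.1.le
    gcongr
    exact hx.2.le
  have h2 := h.congr fun x _ => ordinaryHypergeometric_eq_tsum_hypCoeff a b c x
  exact (h2.continuousAt (Ioo_mem_nhds ht.1 htr)).continuousWithinAt

/-- The Mellin type integral of the hypergeometric function. -/
theorem integral_ordinaryHypergeometric {a b c p : ℝ} (hb : 0 < b) (hc : 0 < c) (hp : 0 < p)
    (h1 : a + b < p + c) (h2 : b + |a| < p + c) :
    IntegrableOn (fun t => ordinaryHypergeometric a b c t * (t ^ (c - 1) * (1 - t) ^ (p - 1)))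
      (Ioo (0 : ℝ) 1) ∧
    ∫ t in Ioo (0 : ℝ) 1, ordinaryHypergeometric a b c t * (t ^ (c - 1) * (1 - t) ^ (p - 1)) =
      Real.Gamma c * Real.Gamma p * Real.Gamma (p + c - a - b) /
        (Real.Gamma (p + c - a) * Real.Gamma (p + c - b)) := by
  -- `q > a + b - c` dominates the coefficients, and `q < p` keeps the dominating weight integrable
  -- at `1`.
  obtain ⟨q, hq1, hq2⟩ : ∃ q, max 0 (a + b - c) < q ∧ q < p :=
    exists_between (max_lt hp (by linarith))
  have hq0 : 0 < q := (le_max_left _ _).trans_lt hq1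
  have hq3 := (le_max_right _ _).trans_lt hq1
  obtain ⟨C, hC0, hC⟩ := exists_abs_hypCoeff_le (a := a) (q := q) hb hc hq0 (by linarith)
  obtain ⟨hi, hs⟩ := powerSeries_betaWeight hq0.le hC hc hq2
    (fun t ht => hasSum_ordinaryHypergeometric hb hc (abs_lt.2 ⟨by linarith [ht.1], ht.2⟩))
  refine ⟨hi, ?_⟩
  have hpc : 0 < p + c := by linarith
  have hG := (Real.Gamma_pos_of_pos hpc).ne'
  -- Termwise beta integrals replace the lower parameter `c` by `p + c`, so Gauss' theorem is
  -- applied there.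
  have hg := (hasSum_hypCoeff hb h2).mul_right (Real.Gamma c * Real.Gamma p / Real.Gamma (p + c))
  refine (hs.unique ?_).trans (?_ : Real.Gamma (p + c) * Real.Gamma (p + c - a - b) /
    (Real.Gamma (p + c - a) * Real.Gamma (p + c - b)) *
      (Real.Gamma c * Real.Gamma p / Real.Gamma (p + c)) = _)
  · convert! hg using 1
    funext n
    have := (poch_pos hc n).ne'
    have := (poch_pos hpc n).ne'
    rw [show c + n + p = p + c + n by ring, Real.Gamma_add_natCast hc, Real.Gamma_add_natCast hpc,
      hypCoeff, hypCoeff]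
    field_simp
  · field_simp

/-! ### Moments, continuity and bounds of the fractional Bessel kernel. -/

theorem one_sub_sq_div_sq_mem_Ioo {x y : ℝ} (hx : 0 < x) (hxy : x < y) :
    1 - x ^ 2 / y ^ 2 ∈ Ioo (0 : ℝ) 1 := by
  have hy := hx.trans hxy
  have h : x ^ 2 / y ^ 2 < 1 := by
    rw [div_lt_one (by positivity)]
    gcongr
  have h' : 0 < x ^ 2 / y ^ 2 := by positivity
  exact ⟨by linarith, by linarith⟩

theorem image_one_sub_sq_div_sq {y : ℝ} (hy : 0 < y) :
    (fun x => 1 - x ^ 2 / y ^ 2) '' Ioo 0 y = Ioo (0 : ℝ) 1 := by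
  ext t
  constructor
  · rintro ⟨x, hx, rfl⟩
    exact one_sub_sq_div_sq_mem_Ioo hx.1 hx.2
  · intro ht
    have h1 : 0 < 1 - t := by linarith [ht.2]
    refine ⟨y * √(1 - t), ⟨by positivity, ?_⟩, ?_⟩
    · have : √(1 - t) < 1 := by rw [Real.sqrt_lt' one_pos]; linarith [ht.1]
      nlinarith
    · simp only [mul_pow, Real.sq_sqrt h1.le]
      field_simp
      ring

theorem hasDerivAt_one_sub_sq_div_sq (y x : ℝ) :
    HasDerivAt (fun x => 1 - x ^ 2 / y ^ 2) (-(2 * x / y ^ 2)) x := by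
  have := ((hasDerivAt_pow 2 x).div_const (y ^ 2)).const_sub 1
  simpa using this

theorem injOn_one_sub_sq_div_sq {y : ℝ} (hy : 0 < y) :
    InjOn (fun x => 1 - x ^ 2 / y ^ 2) (Ioo 0 y) := by
  intro x hx z hz h
  simp only at h
  have : x ^ 2 = z ^ 2 := by field_simp at h; linarith
  exact (pow_left_inj₀ hx.1.le hz.1.le two_ne_zero).1 this

/-- Prepares the substitution `t = 1 - x² / y²`: the factor `|-(2 * x / y ^ 2)|` is its Jacobian,
and what remains depends on `x` only through `t`. -/
theorem rpow_mul_besselKernel {ν α p x y : ℝ} (hx : 0 < x) (hxy : x < y) :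
    x ^ (2 * p - 1) * besselKernel ν α x y =
      2 ^ (-2 * α) / Real.Gamma (2 * α) * y ^ (2 * p - 1 + 2 * α) *
        (|-(2 * x / y ^ 2)| •
          (ordinaryHypergeometric (α + (ν - 1) / 2) α (2 * α) (1 - x ^ 2 / y ^ 2) *
            ((1 - x ^ 2 / y ^ 2) ^ (2 * α - 1) * (1 - (1 - x ^ 2 / y ^ 2)) ^ (p - 1)))) := by
  have hy := hx.trans hxy
  obtain ⟨h0, -⟩ := one_sub_sq_div_sq_mem_Ioo hx hxy
  rw [besselKernel, show (y ^ 2 - x ^ 2) / (2 * y) = y / 2 * (1 - x ^ 2 / y ^ 2) by field_simp,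
    Real.mul_rpow (by positivity) h0.le, abs_neg, abs_of_pos (by positivity), sub_sub_cancel,
    smul_eq_mul, Real.div_rpow hy.le (by positivity),
    Real.div_rpow (by positivity) (by positivity), ← Real.rpow_natCast x, ← Real.rpow_natCast y,
    ← Real.rpow_mul hx.le, ← Real.rpow_mul hy.le]
  have e1 : x ^ (((2 : ℕ) : ℝ) * (p - 1)) * x = x ^ (2 * p - 1) := by
    rw [← Real.rpow_add_one hx.ne']; congr 1; push_cast; ring
  have e2 : y ^ (2 * p - 1 + 2 * α) =
      y ^ (2 * α - 1) * y ^ (((2 : ℕ) : ℝ) * (p - 1)) * y ^ (((2 : ℕ) : ℝ)) := by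
    rw [← Real.rpow_add hy, ← Real.rpow_add hy]; congr 1; push_cast; ring
  have e3 : (2 : ℝ) ^ (-2 * α) = 1 / (2 * 2 ^ (2 * α - 1)) := by
    rw [Real.rpow_sub_one two_ne_zero, mul_div_cancel₀ _ two_ne_zero, neg_mul,
      Real.rpow_neg two_pos.le, one_div]
  have hy1 := (Real.rpow_pos_of_pos hy (((2 : ℕ) : ℝ) * (p - 1))).ne'
  have hy2 := (Real.rpow_pos_of_pos hy (((2 : ℕ) : ℝ))).ne'
  have h21 := (Real.rpow_pos_of_pos (two_pos (α := ℝ)) (2 * α - 1)).ne'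
  rw [e3, e2, ← e1]
  field_simp

theorem ordinaryHypergeometric_betaWeight_of_besselKernel {ν α p : ℝ} (hν : 0 ≤ ν) (hα : 0 < α) (hp : (ν + 1) / 2 ≤ p) :
    (IntegrableOn (fun t => ordinaryHypergeometric (α + (ν - 1) / 2) α (2 * α) t *
      (t ^ (2 * α - 1) * (1 - t) ^ (p - 1))) (Ioo (0 : ℝ) 1)) ∧
    ∫ t in Ioo (0 : ℝ) 1, ordinaryHypergeometric (α + (ν - 1) / 2) α (2 * α) t *
      (t ^ (2 * α - 1) * (1 - t) ^ (p - 1)) =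
      Real.Gamma (2 * α) * Real.Gamma p * Real.Gamma (p - (ν - 1) / 2) /
        (Real.Gamma (p - (ν - 1) / 2 + α) * Real.Gamma (p + α)) := by
  have h := integral_ordinaryHypergeometric (a := α + (ν - 1) / 2) (b := α) (c := 2 * α) (p := p)
    hα (by positivity) (by linarith) (by linarith) (by
      rw [← lt_sub_iff_add_lt', abs_lt]
      constructor <;> linarith)
  rwa [show p + 2 * α - (α + (ν - 1) / 2) - α = p - (ν - 1) / 2 by ring,
    show p + 2 * α - (α + (ν - 1) / 2) = p - (ν - 1) / 2 + α by ring,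
    show p + 2 * α - α = p + α by ring] at h

theorem integrableOn_rpow_mul_besselKernel {ν α p y : ℝ} (hν : 0 ≤ ν) (hα : 0 < α)
    (hp : (ν + 1) / 2 ≤ p) (hy : 0 < y) :
    IntegrableOn (fun x => x ^ (2 * p - 1) * besselKernel ν α x y) (Ioo 0 y) := by
  have h := (ordinaryHypergeometric_betaWeight_of_besselKernel hν hα hp).1
  rw [← image_one_sub_sq_div_sq hy, integrableOn_image_iff_integrableOn_abs_deriv_smul
    measurableSet_Ioo (fun x _ => (hasDerivAt_one_sub_sq_div_sq y x).hasDerivWithinAt)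
    (injOn_one_sub_sq_div_sq hy)] at h
  exact IntegrableOn.congr_fun (h.const_mul _)
    (fun x hx => (rpow_mul_besselKernel hx.1 hx.2).symm) measurableSet_Ioo

theorem integral_rpow_mul_besselKernel {ν α p y : ℝ} (hν : 0 ≤ ν) (hα : 0 < α)
    (hp : (ν + 1) / 2 ≤ p) (hy : 0 < y) :
    ∫ x in Ioo 0 y, x ^ (2 * p - 1) * besselKernel ν α x y =
      2 ^ (-2 * α) * (Real.Gamma p * Real.Gamma (p - (ν - 1) / 2) /
        (Real.Gamma (p - (ν - 1) / 2 + α) * Real.Gamma (p + α))) * y ^ (2 * p - 1 + 2 * α) := by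
  have h := (ordinaryHypergeometric_betaWeight_of_besselKernel hν hα hp).2
  rw [← image_one_sub_sq_div_sq hy, integral_image_eq_integral_abs_deriv_smul
    measurableSet_Ioo (fun x _ => (hasDerivAt_one_sub_sq_div_sq y x).hasDerivWithinAt)
    (injOn_one_sub_sq_div_sq hy)] at h
  rw [setIntegral_congr_fun measurableSet_Ioo (fun x hx => rpow_mul_besselKernel hx.1 hx.2),
    integral_const_mul, h]
  have := (Real.Gamma_pos_of_pos (by positivity : 0 < 2 * α)).ne'
  field_simp

/-- Homogeneity of the kernel: after the substitution `y` survives only as a power. Integrability is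
supplied separately by `integrableOn_rpow_nu_mul_besselKernel`. -/
theorem exists_integral_abs_rpow_mul_besselKernel (ν α : ℝ) :
    ∃ C, 0 ≤ C ∧ ∀ y, 0 < y → ∫ x in Ioo 0 y, ‖x ^ ν * besselKernel ν α x y‖ =
      C * y ^ (2 * α + ν) := by
  set g : ℝ → ℝ := fun t => ordinaryHypergeometric (α + (ν - 1) / 2) α (2 * α) t *
      (t ^ (2 * α - 1) * (1 - t) ^ ((ν + 1) / 2 - 1)) with hg
  refine ⟨‖2 ^ (-2 * α) / Real.Gamma (2 * α)‖ * ∫ t in Ioo (0 : ℝ) 1, ‖g t‖,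
    mul_nonneg (norm_nonneg _) (integral_nonneg fun _ => norm_nonneg _), fun y hy => ?_⟩
  rw [← image_one_sub_sq_div_sq hy, integral_image_eq_integral_abs_deriv_smul
    measurableSet_Ioo (fun x _ => (hasDerivAt_one_sub_sq_div_sq y x).hasDerivWithinAt)
    (injOn_one_sub_sq_div_sq hy), mul_right_comm, ← integral_const_mul]
  refine setIntegral_congr_fun measurableSet_Ioo fun x hx => ?_
  have h := rpow_mul_besselKernel (ν := ν) (α := α) (p := (ν + 1) / 2) hx.1 hx.2
  rw [show 2 * ((ν + 1) / 2) - 1 = ν by ring] at h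
  simp only [h, norm_mul, Real.norm_of_nonneg (Real.rpow_nonneg hy.le _),
    Real.norm_eq_abs, abs_abs, hg, add_comm ν, smul_eq_mul]

theorem continuousOn_besselKernel {ν α : ℝ} (hα : 0 < α) :
    ContinuousOn (fun p : ℝ × ℝ => besselKernel ν α p.1 p.2) {p | 0 < p.1 ∧ p.1 < p.2} := by
  unfold besselKernel
  have hy : ∀ p ∈ {p : ℝ × ℝ | 0 < p.1 ∧ p.1 < p.2}, p.2 ≠ 0 := fun p hp => (hp.1.trans hp.2).ne'
  refine (continuousOn_const.mul (ContinuousOn.rpow_const (ContinuousOn.div (by fun_prop)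
    (by fun_prop) fun p hp => mul_ne_zero two_ne_zero (hy p hp)) fun p hp => Or.inl ?_)).mul
    ((continuousOn_ordinaryHypergeometric hα (by positivity)).comp
      (continuousOn_const.sub (ContinuousOn.div (by fun_prop) (by fun_prop)
        fun p hp => pow_ne_zero 2 (hy p hp))) fun p hp => one_sub_sq_div_sq_mem_Ioo hp.1 hp.2)
  have h1 := hp.1
  have h2 := hp.2
  have : p.1 ^ 2 < p.2 ^ 2 := by gcongr
  exact div_ne_zero (by linarith) (mul_ne_zero two_ne_zero (hy p hp))

/-- The hypergeometric function grows at most like `(1 - t) ^ (-q)` for positive `q > (ν - 1) / 2`.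
The choice `q = (ν + 1) / 2` yields the factor `y ^ (ν + 1)`, which matches the weight `y ^ (2α +
ν)`. -/
theorem exists_abs_besselKernel_le {ν α : ℝ} (hν : 0 ≤ ν) (hα : 0 < α) :
    ∃ C, 0 ≤ C ∧ ∀ x y, 0 < x → x < y → |besselKernel ν α x y| ≤
      C * ((y ^ 2 - x ^ 2) / (2 * y)) ^ (2 * α - 1) * (x ^ 2 / y ^ 2) ^ (-((ν + 1) / 2)) := by
  obtain ⟨C, hC0, hC⟩ := exists_abs_ordinaryHypergeometric_le (a := α + (ν - 1) / 2) (b := α)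
    (c := 2 * α) (q := (ν + 1) / 2) hα (by positivity) (by positivity) (by linarith)
  have hG := Real.Gamma_pos_of_pos (by positivity : 0 < 2 * α)
  refine ⟨1 / Real.Gamma (2 * α) * C, by positivity, fun x y hx hxy => ?_⟩
  have hy := hx.trans hxy
  have hm := one_sub_sq_div_sq_mem_Ioo hx hxy
  have hd : 0 ≤ (y ^ 2 - x ^ 2) / (2 * y) := by
    have : x ^ 2 < y ^ 2 := by gcongr
    exact div_nonneg (by linarith) (by linarith)
  have h := hC _ ⟨hm.1.le, hm.2⟩
  rw [sub_sub_cancel] at h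
  have hr := Real.rpow_nonneg hd (2 * α - 1)
  rw [besselKernel, abs_mul, abs_mul, abs_of_pos (by positivity : 0 < 1 / Real.Gamma (2 * α)),
    abs_of_nonneg hr]
  calc _ ≤ 1 / Real.Gamma (2 * α) * ((y ^ 2 - x ^ 2) / (2 * y)) ^ (2 * α - 1) *
        (C * (x ^ 2 / y ^ 2) ^ (-((ν + 1) / 2))) := by gcongr
    _ = _ := by ring

/-! ### The entire part of the Bessel function. -/

/-- The coefficients of the entire function `besselEntire`. -/
noncomputable def besselCoeff (γ : ℝ) (m : ℕ) : ℝ :=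
  (-1) ^ m / ((m.factorial : ℝ) * Real.Gamma (γ + m + 1))

/-- The entire function `φ_γ` for which `J_γ(z) = (z / 2) ^ γ φ_γ(z² / 4)`. -/
noncomputable def besselEntire (γ w : ℝ) : ℝ := ∑' m, besselCoeff γ m * w ^ m

section

variable {γ : ℝ}

theorem Gamma_add_natCast_add_one_pos (hγ : -1 < γ) (m : ℕ) : 0 < Real.Gamma (γ + m + 1) :=
  Real.Gamma_pos_of_pos (by linarith [(Nat.cast_nonneg m : (0 : ℝ) ≤ m)])

theorem besselCoeff_ne_zero (hγ : -1 < γ) (m : ℕ) : besselCoeff γ m ≠ 0 := by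
  have := Gamma_add_natCast_add_one_pos hγ m
  exact div_ne_zero (by simp) (by positivity)

theorem besselCoeff_succ_mul (γ : ℝ) (m : ℕ) :
    besselCoeff γ (m + 1) * (m + 1) = -besselCoeff (γ + 1) m := by
  simp only [besselCoeff, Nat.factorial_succ]
  push_cast
  rw [show γ + 1 + m + 1 = γ + (m + 1) + 1 by ring, pow_succ]
  have : (m : ℝ) + 1 ≠ 0 := by positivity
  field_simp

theorem besselCoeff_eq_mul (hγ : -1 < γ) (m : ℕ) :
    besselCoeff γ m = (γ + 1 + m) * besselCoeff (γ + 1) m := by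
  have h : γ + m + 1 ≠ 0 := by linarith [(Nat.cast_nonneg m : (0 : ℝ) ≤ m)]
  have := (Gamma_add_natCast_add_one_pos hγ m).ne'
  simp only [besselCoeff]
  rw [show γ + 1 + m + 1 = γ + m + 1 + 1 by ring, Real.Gamma_add_one h,
    show γ + 1 + m = γ + m + 1 by ring]
  field_simp

theorem hasFPowerSeriesOnBall_besselEntire (hγ : -1 < γ) :
    HasFPowerSeriesOnBall (besselEntire γ)
      (FormalMultilinearSeries.ofScalars ℝ (besselCoeff γ)) 0 ⊤ := by
  have hr : (FormalMultilinearSeries.ofScalars ℝ (besselCoeff γ)).radius = ⊤ := by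
    refine FormalMultilinearSeries.ofScalars_radius_eq_top_of_tendsto ℝ _
      (Eventually.of_forall (besselCoeff_ne_zero hγ)) ?_
    have h0 : Tendsto (fun n : ℕ => ((n : ℝ) + (γ + 1))⁻¹) atTop (𝓝 0) :=
      (tendsto_atTop_add_const_right _ _ tendsto_natCast_atTop_atTop).inv_tendsto_atTop
    refine squeeze_zero (fun n => by positivity) (fun n => ?_) h0
    have hn : (0 : ℝ) ≤ n := Nat.cast_nonneg n
    have hp : 0 < γ + 1 + n := by linarith
    have h1 := besselCoeff_eq_mul hγ n
    have h2 := besselCoeff_succ_mul γ n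
    have h3 := besselCoeff_ne_zero (γ := γ + 1) (by linarith) n
    have h4 : besselCoeff γ (n + 1) = -besselCoeff (γ + 1) n / (n + 1) := by
      rw [← h2]; field_simp
    rw [Nat.succ_eq_add_one, h1, h4, norm_div, norm_neg, norm_mul, Real.norm_of_nonneg hp.le,
      Real.norm_of_nonneg (by positivity : (0 : ℝ) ≤ n + 1)]
    have h5 : ‖besselCoeff (γ + 1) n‖ ≠ 0 := norm_ne_zero_iff.2 h3
    rw [show ‖besselCoeff (γ + 1) n‖ / (n + 1) / ((γ + 1 + n) * ‖besselCoeff (γ + 1) n‖) =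
      (γ + 1 + n)⁻¹ * (n + 1 : ℝ)⁻¹ by field_simp, add_comm (n : ℝ) (γ + 1)]
    exact mul_le_of_le_one_right (by positivity) (inv_le_one_of_one_le₀ (by linarith))
  have h := (FormalMultilinearSeries.ofScalars ℝ (besselCoeff γ)).hasFPowerSeriesOnBall
    (by rw [hr]; exact ENNReal.zero_lt_top)
  rw [hr] at h
  convert h using 1
  funext w
  simp [besselEntire, FormalMultilinearSeries.sum, mul_comm]

theorem analyticOnNhd_besselEntire (hγ : -1 < γ) : AnalyticOnNhd ℝ (besselEntire γ) univ := by
  simpa using (hasFPowerSeriesOnBall_besselEntire hγ).analyticOnNhd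

theorem continuous_besselEntire (hγ : -1 < γ) : Continuous (besselEntire γ) :=
  continuousOn_univ.1 (analyticOnNhd_besselEntire hγ).continuousOn

theorem hasSum_besselEntire (hγ : -1 < γ) (w : ℝ) :
    HasSum (fun m => besselCoeff γ m * w ^ m) (besselEntire γ w) := by
  simpa [mul_comm] using (hasFPowerSeriesOnBall_besselEntire hγ).hasSum (y := w) (by simp)

theorem besselEntire_zero (γ : ℝ) : besselEntire γ 0 = 1 / Real.Gamma (γ + 1) := by
  rw [besselEntire, tsum_eq_single 0 (fun m hm => by simp [hm])]
  simp [besselCoeff]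

theorem hasSum_deriv_besselEntire (hγ : -1 < γ) (w : ℝ) :
    HasSum (fun m : ℕ => besselCoeff γ m * (m * w ^ (m - 1))) (-besselEntire (γ + 1) w) := by
  -- The term `m = 0` vanishes through its factor `m`, whatever the truncated exponent `m - 1`.
  rw [← hasSum_nat_add_iff' 1]
  have h := (hasSum_besselEntire (γ := γ + 1) (by linarith) w).neg
  simp only [Finset.range_one, Finset.sum_singleton, Nat.cast_zero, zero_mul, mul_zero, sub_zero]
  convert! h using 2 with m
  rw [← neg_mul, ← besselCoeff_succ_mul]
  push_cast
  ring

theorem hasDerivAt_besselEntire (hγ : -1 < γ) (w : ℝ) :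
    HasDerivAt (besselEntire γ) (-besselEntire (γ + 1) w) w := by
  rw [← (hasSum_deriv_besselEntire hγ w).tsum_eq]
  refine hasDerivAt_tsum_of_isPreconnected (t := Metric.ball 0 (|w| + 1)) (y₀ := w)
    (g := fun m w => besselCoeff γ m * w ^ m)
    (g' := fun m w => besselCoeff γ m * (m * w ^ (m - 1)))
    (hasSum_deriv_besselEntire hγ (|w| + 1)).summable.norm
    Metric.isOpen_ball (convex_ball _ _).isPreconnected
    (fun m x _ => (hasDerivAt_pow m x).const_mul _) (fun m x hx => ?_) (by simp)
    (hasSum_besselEntire hγ w).summable (by simp)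
  simp only [norm_mul, norm_pow]
  have : ‖x‖ ≤ ‖|w| + 1‖ := by
    rw [Real.norm_of_nonneg (by positivity : 0 ≤ |w| + 1)]
    simpa using (mem_ball_zero_iff.1 hx).le
  gcongr

/-- Since differentiation sends `φ_γ` to `-φ_{γ+1}`, this recurrence is Bessel's equation `w φ'' +
(γ + 1) φ' + φ = 0`. -/
theorem besselEntire_eq (hγ : -1 < γ) (w : ℝ) :
    besselEntire γ w = (γ + 1) * besselEntire (γ + 1) w - w * besselEntire (γ + 2) w := by
  have h1 := (hasSum_besselEntire (γ := γ + 1) (by linarith) w).mul_left (γ + 1)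
  have h2 := (hasSum_deriv_besselEntire (γ := γ + 1) (by linarith) w).mul_left w
  refine (hasSum_besselEntire hγ w).unique ?_
  convert! h1.add h2 using 1
  · funext m
    rw [besselCoeff_eq_mul hγ]
    cases m with
    | zero => simp
    | succ m => rw [Nat.add_sub_cancel, pow_succ]; ring
  · rw [show γ + 1 + 1 = γ + 2 by ring]; ring

/-- The energy estimate for Bessel's equation. -/
theorem abs_besselEntire_le (hγ : -1 / 2 ≤ γ) {w : ℝ} (hw : 0 ≤ w) :
    |besselEntire γ w| ≤ 1 / Real.Gamma (γ + 1) := by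
  have hγ0 : -1 < γ := by linarith
  have hγ1 : -1 < γ + 1 := by linarith
  have hG := Real.Gamma_pos_of_pos (by linarith : 0 < γ + 1)
  -- This is `φ² + w φ'²`. By Bessel's equation its derivative is `-(2γ + 1) φ'²`, nonpositive
  -- exactly because `γ ≥ -1/2`; hence `φ(w)² ≤ E w ≤ E 0`.
  set E : ℝ → ℝ := fun w => besselEntire γ w ^ 2 + w * besselEntire (γ + 1) w ^ 2 with hE
  have hd : ∀ w, HasDerivAt E (-(2 * γ + 1) * besselEntire (γ + 1) w ^ 2) w := fun w => by
    have h := ((hasDerivAt_besselEntire hγ0 w).pow 2).add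
      ((hasDerivAt_id w).mul ((hasDerivAt_besselEntire hγ1 w).pow 2))
    refine h.congr_deriv ?_
    have := besselEntire_eq hγ0 w
    rw [show γ + 1 + 1 = γ + 2 by ring]
    simp only [this, id_eq, Pi.pow_apply]
    norm_num
    ring
  have ha : Antitone E := antitone_of_deriv_nonpos (fun w => (hd w).differentiableAt) fun w => by
    rw [(hd w).deriv, neg_mul]
    have : 0 ≤ (2 * γ + 1) * besselEntire (γ + 1) w ^ 2 :=
      mul_nonneg (by linarith) (sq_nonneg _)
    linarith
  have h := ha hw
  simp only [hE, besselEntire_zero, zero_mul, add_zero] at h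
  refine abs_le_of_sq_le_sq (le_trans ?_ h) (by positivity)
  have := mul_nonneg hw (sq_nonneg (besselEntire (γ + 1) w))
  linarith

end

/-! ### The Hankel kernel and its integral against the Bessel kernel. -/

theorem besselJ_eq (γ : ℝ) {z : ℝ} (hz : 0 < z) :
    besselJ γ z = (z / 2) ^ γ * besselEntire γ ((z / 2) ^ 2) := by
  rw [besselJ, besselEntire, ← tsum_mul_left]
  refine tsum_congr fun m => ?_
  rw [Real.rpow_add (by positivity), ← Nat.cast_ofNat, ← Nat.cast_mul, Real.rpow_natCast, pow_mul,
    besselCoeff]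
  push_cast
  ring

theorem hankelKernel_eq (ν : ℝ) {ξ x : ℝ} (hξ : 0 < ξ) (hx : 0 < x) :
    hankelKernel ν ξ x =
      (ξ / 2) ^ ((ν - 1) / 2) * x ^ ν * besselEntire ((ν - 1) / 2) ((x * ξ / 2) ^ 2) := by
  rw [hankelKernel, besselJ_eq _ (by positivity), mul_div_assoc, Real.mul_rpow hx.le (by positivity),
    show x ^ ν = x ^ ((ν - 1) / 2) * x ^ ((ν + 1) / 2) by rw [← Real.rpow_add hx]; ring_nf]
  ring

theorem continuousOn_hankelKernel {ν ξ : ℝ} (hν : 0 ≤ ν) (hξ : 0 < ξ) :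
    ContinuousOn (hankelKernel ν ξ) (Ioi 0) := by
  have hc := continuous_besselEntire (γ := (ν - 1) / 2) (by linarith)
  refine ContinuousOn.congr (f := fun x => (ξ / 2) ^ ((ν - 1) / 2) * x ^ ν *
    besselEntire ((ν - 1) / 2) ((x * ξ / 2) ^ 2)) ?_ fun x hx => hankelKernel_eq ν hξ hx
  exact (continuousOn_const.mul (continuousOn_id.rpow_const fun x hx => Or.inl hx.ne')).mul
    (by fun_prop)

theorem abs_hankelKernel_le {ν ξ x : ℝ} (hν : 0 ≤ ν) (hξ : 0 < ξ) (hx : 0 < x) :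
    |hankelKernel ν ξ x| ≤ (ξ / 2) ^ ((ν - 1) / 2) / Real.Gamma ((ν + 1) / 2) * x ^ ν := by
  have h := abs_besselEntire_le (γ := (ν - 1) / 2) (by linarith) (sq_nonneg (x * ξ / 2))
  rw [show (ν - 1) / 2 + 1 = (ν + 1) / 2 by ring] at h
  have h1 : 0 ≤ (ξ / 2) ^ ((ν - 1) / 2) * x ^ ν := by positivity
  rw [hankelKernel_eq ν hξ hx, abs_mul, abs_of_nonneg h1]
  calc _ ≤ (ξ / 2) ^ ((ν - 1) / 2) * x ^ ν * (1 / Real.Gamma ((ν + 1) / 2)) := by gcongr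
    _ = _ := by ring

/-- Up to a positive factor the kernel is a real analytic function with nonzero value at `0`, so its
zero set is discrete and hence null. -/
theorem ae_hankelKernel_ne_zero {ν ξ : ℝ} (hν : 0 ≤ ν) (hξ : 0 < ξ) :
    ∀ᵐ x ∂(volume.restrict (Ioi (0 : ℝ))), hankelKernel ν ξ x ≠ 0 := by
  set g : ℝ → ℝ := fun x => besselEntire ((ν - 1) / 2) ((x * ξ / 2) ^ 2) with hg
  have ha : AnalyticOnNhd ℝ g univ := by
    refine (analyticOnNhd_besselEntire (γ := (ν - 1) / 2) (by linarith)).comp (t := univ)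
      (f := fun x : ℝ => (x * ξ / 2) ^ 2) (fun x _ => ?_) (mapsTo_univ _ _)
    fun_prop
  have h := ha.preimage_zero_mem_codiscrete (x := 0) (by
    simp only [hg, zero_mul, zero_div, ne_eq, OfNat.ofNat_ne_zero, not_false_eq_true, zero_pow]
    rw [besselEntire_zero]
    exact (one_div_pos.2 (Real.Gamma_pos_of_pos (by linarith))).ne')
  have h2 : ∀ᵐ x, g x ≠ 0 := by
    have := ae_restrict_le_codiscreteWithin (μ := (volume : Measure ℝ)) MeasurableSet.univ h
    rwa [Measure.restrict_univ] at this
  filter_upwards [ae_restrict_of_ae h2, ae_restrict_mem measurableSet_Ioi] with x hx hx0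
  rw [hankelKernel_eq ν hξ hx0]
  have hx0' : 0 < x := hx0
  exact mul_ne_zero (by positivity) hx

theorem continuousOn_hankelKernel_mul_besselKernel {ν α ξ : ℝ} (hν : 0 ≤ ν) (hα : 0 < α)
    (hξ : 0 < ξ) :
    ContinuousOn (fun p : ℝ × ℝ => hankelKernel ν ξ p.1 * besselKernel ν α p.1 p.2)
      {p | 0 < p.1 ∧ p.1 < p.2} :=
  ((continuousOn_hankelKernel hν hξ).comp continuousOn_fst fun _ hp => hp.1).mul
    (continuousOn_besselKernel hα)

theorem norm_hankelKernel_mul_besselKernel_le {ν α ξ x y : ℝ} (hν : 0 ≤ ν) (hξ : 0 < ξ)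
    (hx : 0 < x) :
    ‖hankelKernel ν ξ x * besselKernel ν α x y‖ ≤
      (ξ / 2) ^ ((ν - 1) / 2) / Real.Gamma ((ν + 1) / 2) * ‖x ^ ν * besselKernel ν α x y‖ := by
  rw [norm_mul, norm_mul, Real.norm_of_nonneg (Real.rpow_nonneg hx.le ν), ← mul_assoc]
  exact mul_le_mul_of_nonneg_right (abs_hankelKernel_le hν hξ hx) (norm_nonneg _)

theorem integrableOn_rpow_nu_mul_besselKernel {ν α y : ℝ} (hν : 0 ≤ ν) (hα : 0 < α)
    (hy : 0 < y) : IntegrableOn (fun x => x ^ ν * besselKernel ν α x y) (Ioo 0 y) := by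
  have h := integrableOn_rpow_mul_besselKernel hν hα (le_refl ((ν + 1) / 2)) hy
  rwa [show 2 * ((ν + 1) / 2) - 1 = ν by ring] at h

theorem integrableOn_hankelKernel_mul_besselKernel {ν α ξ y : ℝ} (hν : 0 ≤ ν) (hα : 0 < α)
    (hξ : 0 < ξ) (hy : 0 < y) :
    IntegrableOn (fun x => hankelKernel ν ξ x * besselKernel ν α x y) (Ioo 0 y) := by
  refine Integrable.mono' ((integrableOn_rpow_nu_mul_besselKernel hν hα hy).norm.const_mul _) ?_
    ((ae_restrict_iff' measurableSet_Ioo).2 (ae_of_all _ fun x hx =>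
      norm_hankelKernel_mul_besselKernel_le hν hξ hx.1))
  refine ContinuousOn.aestronglyMeasurable ?_ measurableSet_Ioo
  exact (continuousOn_hankelKernel_mul_besselKernel hν hα hξ).comp
    (f := fun x => (x, y)) (by fun_prop) fun x hx => hx

/-- The Hankel transform of the kernel of the fractional Bessel integral. -/
theorem integral_hankelKernel_mul_besselKernel {ν α ξ y : ℝ} (hν : 0 ≤ ν) (hα : 0 < α)
    (hξ : 0 < ξ) (hy : 0 < y) :
    ∫ x in Ioo 0 y, hankelKernel ν ξ x * besselKernel ν α x y =
      ξ ^ (-2 * α) * wrightKernel ν α ξ y := by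
  set γ := (ν - 1) / 2 with hγ
  have hγ1 : -1 < γ := by rw [hγ]; linarith
  set A := (ξ / 2) ^ γ with hA
  have hA0 : 0 ≤ A := by positivity
  have hI := integrableOn_rpow_nu_mul_besselKernel hν hα hy
  have hb : Summable fun m => ‖besselCoeff γ m * ((y * ξ / 2) ^ 2) ^ m‖ :=
    (hasSum_besselEntire hγ1 _).summable.norm
  -- The `m`-th term is the moment with `p = m + γ + 1`, for which `Γ(p - γ) = m!` and `Γ(p)` cancel
  -- the denominator of `besselCoeff γ m`.
  have hF : ∀ x ∈ Ioo 0 y, ∀ m : ℕ,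
      A * (besselCoeff γ m * ((x * ξ / 2) ^ 2) ^ m) * (x ^ ν * besselKernel ν α x y) =
      A * besselCoeff γ m * ((ξ / 2) ^ 2) ^ m *
        (x ^ (2 * (m + γ + 1) - 1) * besselKernel ν α x y) := fun x hx m => by
    have e : x ^ (2 * (m + γ + 1) - 1) = (x ^ 2) ^ m * x ^ ν := by
      rw [← pow_mul, ← Real.rpow_natCast x, ← Real.rpow_add hx.1]
      congr 1
      push_cast
      rw [hγ]
      ring
    rw [e, mul_div_assoc, mul_pow, mul_pow]
    ring
  -- Absolute values of the power series terms increase with `x`, so their values at `x = y`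
  -- dominate.
  have hs := hasSum_integral_of_dominated_convergence (μ := volume.restrict (Ioo (0 : ℝ) y))
    (F := fun (m : ℕ) x => A * (besselCoeff γ m * ((x * ξ / 2) ^ 2) ^ m) *
      (x ^ ν * besselKernel ν α x y))
    (f := fun x => hankelKernel ν ξ x * besselKernel ν α x y)
    (fun m x => ‖besselCoeff γ m * ((y * ξ / 2) ^ 2) ^ m‖ * (A * ‖x ^ ν * besselKernel ν α x y‖))
    (fun m => ?_) (fun m => (ae_restrict_iff' measurableSet_Ioo).2 (ae_of_all _ fun x hx => ?_))
    (ae_of_all _ fun x => hb.mul_right _) ?_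
    ((ae_restrict_iff' measurableSet_Ioo).2 (ae_of_all _ fun x hx => ?_))
  · rw [← hs.tsum_eq, wrightKernel, wrightJ, mul_comm (tsum _), ← mul_assoc, ← tsum_mul_left]
    refine tsum_congr fun m => ?_
    rw [setIntegral_congr_fun measurableSet_Ioo (fun x hx => hF x hx m), integral_const_mul,
      integral_rpow_mul_besselKernel hν hα (by rw [hγ]; linarith [(Nat.cast_nonneg m : (0:ℝ) ≤ m)]) hy,
      ← hγ, show (m : ℝ) + γ + 1 - γ = m + 1 by ring, Real.Gamma_nat_eq_factorial, besselCoeff,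
      show (m : ℝ) + γ + 1 = γ + m + 1 by ring, show γ + m * 1 + α + 1 = γ + m + 1 + α by ring,
      show α + m + 1 = (m : ℝ) + 1 + α by ring, mul_div_assoc y,
      Real.mul_rpow hy.le (by positivity)]
    have e1 : y ^ (2 * (γ + m + 1) - 1 + 2 * α) = y ^ ((ν + 1) / 2) * y ^ (2 * m + γ + 2 * α) := by
      rw [← Real.rpow_add hy]; congr 1; rw [hγ]; ring
    have e2 : (ξ / 2) ^ (2 * m + γ + 2 * α) = ((ξ / 2) ^ 2) ^ m * A * (ξ / 2) ^ (2 * α) := by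
      rw [hA, ← pow_mul, ← Real.rpow_natCast, ← Real.rpow_add (by positivity),
        ← Real.rpow_add (by positivity)]
      push_cast
      rfl
    have e3 : (ξ / 2) ^ (2 * α) = ξ ^ (2 * α) * 2 ^ (-2 * α) := by
      rw [Real.div_rpow hξ.le two_pos.le, neg_mul, Real.rpow_neg two_pos.le, div_eq_mul_inv]
    have e4 : ξ ^ (-2 * α) = (ξ ^ (2 * α))⁻¹ := by rw [neg_mul, Real.rpow_neg hξ.le]
    have hξ2 := (Real.rpow_pos_of_pos hξ (2 * α)).ne'
    have hG := (Gamma_add_natCast_add_one_pos hγ1 m).ne'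
    have hm : (m.factorial : ℝ) ≠ 0 := by positivity
    rw [e1, e2, e3, e4]
    field_simp
  · exact (Continuous.aestronglyMeasurable (by fun_prop)).mul hI.aestronglyMeasurable
  · rw [norm_mul, norm_mul A, Real.norm_of_nonneg hA0, mul_comm A, mul_assoc]
    have : ‖besselCoeff γ m * ((x * ξ / 2) ^ 2) ^ m‖ ≤
        ‖besselCoeff γ m * ((y * ξ / 2) ^ 2) ^ m‖ := by
      rw [norm_mul, norm_mul, norm_pow _ m, norm_pow _ m, Real.norm_of_nonneg (sq_nonneg _),
        Real.norm_of_nonneg (sq_nonneg _)]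
      have := hx.1
      have := hx.2.le
      gcongr
    gcongr
  · simp_rw [tsum_mul_right]
    exact (hI.norm.const_mul A).const_mul _
  · have h := ((hasSum_besselEntire hγ1 ((x * ξ / 2) ^ 2)).mul_left A).mul_right
      (x ^ ν * besselKernel ν α x y)
    rw [hankelKernel_eq ν hξ hx.1]
    convert! h using 1
    ring

/-! ### Fubini on the triangle, with indicators extending the integrands to the plane. -/

section

variable {𝕜 : Type*} [RCLike 𝕜]

theorem measurableSet_pos_lt : MeasurableSet {p : ℝ × ℝ | 0 < p.1 ∧ p.1 < p.2} :=
  (measurableSet_lt measurable_const measurable_fst).inter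
    (measurableSet_lt measurable_fst measurable_snd)

theorem indicator_pos_lt_left {E : Type*} [Zero E] (F : ℝ × ℝ → E) (x : ℝ) :
    (fun y => indicator {p : ℝ × ℝ | 0 < p.1 ∧ p.1 < p.2} F (x, y)) =
      if 0 < x then indicator (Ioi x) (fun y => F (x, y)) else 0 := by
  funext y
  by_cases hx : 0 < x <;> by_cases hxy : x < y <;> simp [indicator, hx, hxy]

theorem indicator_pos_lt_right {E : Type*} [Zero E] (F : ℝ × ℝ → E) (y : ℝ) :
    (fun x => indicator {p : ℝ × ℝ | 0 < p.1 ∧ p.1 < p.2} F (x, y)) =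
      indicator (Ioo 0 y) (fun x => F (x, y)) := by
  funext x
  simp [indicator]

theorem integral_indicator_hankelKernel_mul_besselKernel {ν α ξ : ℝ} (hν : 0 ≤ ν) (hα : 0 < α)
    (hξ : 0 < ξ) (f : ℝ → 𝕜) :
    (fun y => ∫ x, indicator {p : ℝ × ℝ | 0 < p.1 ∧ p.1 < p.2}
      (fun p : ℝ × ℝ => (hankelKernel ν ξ p.1 * besselKernel ν α p.1 p.2) • f p.2) (x, y)) =
    indicator (Ioi 0) fun y => ξ ^ (-2 * α) • (wrightKernel ν α ξ y • f y) := by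
  funext y
  rw [indicator_pos_lt_right, integral_indicator measurableSet_Ioo]
  by_cases hy : 0 < y
  · rw [indicator_of_mem (show y ∈ Ioi 0 from hy), ← mul_smul,
      ← integral_hankelKernel_mul_besselKernel hν hα hξ hy]
    exact integral_smul_const (fun x => hankelKernel ν ξ x * besselKernel ν α x y) (f y)
  · rw [indicator_of_notMem (show y ∉ Ioi 0 from hy), Ioo_eq_empty hy]
    simp

theorem integral_indicator_fracBesselMinus (ν α ξ : ℝ) (f : ℝ → 𝕜) :
    (fun x => ∫ y, indicator {p : ℝ × ℝ | 0 < p.1 ∧ p.1 < p.2}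
      (fun p : ℝ × ℝ => (hankelKernel ν ξ p.1 * besselKernel ν α p.1 p.2) • f p.2) (x, y)) =
    indicator (Ioi 0) fun x => hankelKernel ν ξ x • fracBesselMinus ν α f x := by
  funext x
  rw [indicator_pos_lt_left]
  by_cases hx : 0 < x
  · rw [indicator_of_mem (show x ∈ Ioi 0 from hx), if_pos hx,
      integral_indicator measurableSet_Ioi, fracBesselMinus, ← integral_smul]
    simp only [mul_smul]
  · rw [indicator_of_notMem (show x ∉ Ioi 0 from hx), if_neg hx]
    simp

theorem hankelTransform_fracBesselMinus {ν α ξ : ℝ} (hν : 0 ≤ ν) (hα : 0 < α) (hξ : 0 < ξ)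
    {f : ℝ → 𝕜} (hf : HankelBesselConverges ν α ξ f) :
    (∀ᵐ x ∂(volume.restrict (Ioi (0 : ℝ))),
        IntegrableOn (fun y => besselKernel ν α x y • f y) (Ioi x)) ∧
      IntegrableOn (fun x => hankelKernel ν ξ x • fracBesselMinus ν α f x) (Ioi 0) ∧
      IntegrableOn (fun x => wrightKernel ν α ξ x • f x) (Ioi 0) ∧
      hankelTransform ν (fracBesselMinus ν α f) ξ = ξ ^ (-2 * α) • wrightTransform ν α f ξ := by
  have hi := (integrable_indicator_iff measurableSet_pos_lt).2 hf
  rw [Measure.volume_eq_prod] at hi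
  have hleft := hi.integral_prod_left
  have hright := hi.integral_prod_right
  rw [integral_indicator_fracBesselMinus, integrable_indicator_iff measurableSet_Ioi] at hleft
  rw [integral_indicator_hankelKernel_mul_besselKernel hν hα hξ,
    integrable_indicator_iff measurableSet_Ioi] at hright
  have hξ2 := (Real.rpow_pos_of_pos hξ (-2 * α)).ne'
  refine ⟨?_, hleft, (integrable_fun_smul_iff hξ2 _).1 hright, ?_⟩
  -- Fubini gives integrability of almost every slice multiplied by the constant `hankelKernel ν ξ
  -- x`; this constant is divided out where it is nonzero.
  · filter_upwards [ae_restrict_of_ae hi.prod_right_ae, ae_hankelKernel_ne_zero hν hξ,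
      ae_restrict_mem measurableSet_Ioi] with x hx hne hx0
    rw [indicator_pos_lt_left, if_pos (mem_Ioi.1 hx0), integrable_indicator_iff measurableSet_Ioi] at hx
    simp only [mul_smul] at hx
    exact (integrable_fun_smul_iff hne _).1 hx
  · rw [hankelTransform, wrightTransform, ← integral_smul, ← integral_indicator measurableSet_Ioi,
      ← integral_indicator measurableSet_Ioi,
      ← integral_indicator_hankelKernel_mul_besselKernel hν hα hξ,
      ← integral_indicator_fracBesselMinus]
    exact integral_integral_swap hi

theorem hankelBesselConverges_of_integrableOn {ν α ξ : ℝ} (hν : 0 ≤ ν) (hα : 0 < α) (hξ : 0 < ξ)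
    {f : ℝ → 𝕜} (hf : IntegrableOn (fun y => y ^ (2 * α + ν) • f y) (Ioi 0)) :
    HankelBesselConverges ν α ξ f := by
  obtain ⟨C, hC0, hC⟩ := exists_integral_abs_rpow_mul_besselKernel ν α
  -- Only the weighted function is known to be measurable; dividing by the positive weight recovers
  -- `f`.
  have hfm : AEStronglyMeasurable f (volume.restrict (Ioi 0)) := by
    have h1 : AEStronglyMeasurable (fun y : ℝ => (y ^ (2 * α + ν))⁻¹) (volume.restrict (Ioi 0)) :=
      Measurable.aestronglyMeasurable (by fun_prop)
    refine (h1.smul hf.aestronglyMeasurable).congr ?_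
    filter_upwards [ae_restrict_mem measurableSet_Ioi] with y hy
    exact inv_smul_smul₀ (Real.rpow_pos_of_pos hy _).ne' _
  set S := {p : ℝ × ℝ | 0 < p.1 ∧ p.1 < p.2} with hS
  set F : ℝ × ℝ → 𝕜 :=
    fun p => (hankelKernel ν ξ p.1 * besselKernel ν α p.1 p.2) • f p.2 with hF
  have hm : AEStronglyMeasurable (S.indicator F) (volume.prod volume) := by
    rw [aestronglyMeasurable_indicator_iff measurableSet_pos_lt]
    refine ((continuousOn_hankelKernel_mul_besselKernel hν hα hξ).aestronglyMeasurable
      measurableSet_pos_lt).smul ?_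
    have h2 := hfm.comp_snd (μ := (volume : Measure ℝ))
    rw [← Measure.restrict_univ (μ := (volume : Measure ℝ)), Measure.prod_restrict,
      Measure.restrict_univ] at h2
    have hSs : S ⊆ univ ×ˢ Ioi 0 := fun p hp => ⟨mem_univ _, hp.1.trans hp.2⟩
    exact h2.mono_measure (Measure.restrict_mono hSs le_rfl)
  rw [HankelBesselConverges, ← integrable_indicator_iff measurableSet_pos_lt,
    Measure.volume_eq_prod, integrable_prod_iff' hm]
  constructor
  · refine ae_of_all _ fun y => ?_
    rw [indicator_pos_lt_right, integrable_indicator_iff measurableSet_Ioo]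
    by_cases hy : 0 < y
    · exact (integrableOn_hankelKernel_mul_besselKernel hν hα hξ hy).smul_const (f y)
    · rw [Ioo_eq_empty hy]
      exact integrableOn_empty
  · set B := (ξ / 2) ^ ((ν - 1) / 2) / Real.Gamma ((ν + 1) / 2) with hB
    refine Integrable.mono' (g := indicator (Ioi 0) fun y => B * C * ‖y ^ (2 * α + ν) • f y‖)
      ((integrable_indicator_iff measurableSet_Ioi).2 (hf.norm.const_mul _))
      hm.prod_swap.norm.integral_prod_right' (ae_of_all _ fun y => ?_)
    rw [Real.norm_of_nonneg (integral_nonneg fun _ => norm_nonneg _)]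
    have e := indicator_pos_lt_right F y
    simp only [funext_iff] at e
    simp_rw [← hS] at e
    simp_rw [e, norm_indicator_eq_indicator_norm]
    rw [integral_indicator measurableSet_Ioo]
    by_cases hy : 0 < y
    · rw [indicator_of_mem (show y ∈ Ioi 0 from hy), norm_smul,
        Real.norm_of_nonneg (Real.rpow_nonneg hy.le _)]
      simp only [hF, norm_smul]
      rw [integral_mul_const]
      calc _ ≤ (∫ x in Ioo 0 y, B * ‖x ^ ν * besselKernel ν α x y‖) * ‖f y‖ := by
            refine mul_le_mul_of_nonneg_right (setIntegral_mono_on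
              (by simpa only [norm_mul, IntegrableOn] using
                (integrableOn_hankelKernel_mul_besselKernel hν hα hξ hy).norm)
              ((integrableOn_rpow_nu_mul_besselKernel hν hα hy).norm.const_mul B)
              measurableSet_Ioo fun x hx => ?_) (norm_nonneg _)
            simpa only [norm_mul] using
              norm_hankelKernel_mul_besselKernel_le (α := α) (y := y) hν hξ hx.1
        _ = _ := by rw [integral_const_mul, hC y hy]; ring
    · rw [indicator_of_notMem (show y ∉ Ioi 0 from hy), Ioo_eq_empty hy]
      simp

/-! ### Convergence of the fractional integral at every point. -/

/-- The only singularity is `(y - x) ^ (2α - 1)`, integrable since `α > 0`; the other factors of the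
bound are continuous on the compact interval `[x, b]`. -/
theorem integrableOn_besselKernel_smul_Ioc {ν α x b : ℝ} (hν : 0 ≤ ν) (hα : 0 < α) (hx : 0 < x)
    {f : ℝ → 𝕜} (hf : ContinuousOn f (Ioi 0)) :
    IntegrableOn (fun y => besselKernel ν α x y • f y) (Ioc x b) := by
  obtain ⟨C, hC0, hC⟩ := exists_abs_besselKernel_le hν hα
  have hK : ContinuousOn (fun y => besselKernel ν α x y) (Ioi x) :=
    (continuousOn_besselKernel (ν := ν) hα).comp (f := fun y => (x, y)) (by fun_prop)
      fun y hy => ⟨hx, hy⟩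
  have hpos : ∀ y ∈ Icc x b, 0 < y := fun y hy => hx.trans_le hy.1
  have hc : ContinuousOn (fun y => C * ((y + x) / (2 * y)) ^ (2 * α - 1) *
      (x ^ 2 / y ^ 2) ^ (-((ν + 1) / 2)) * ‖f y‖) (Icc x b) := by
    refine ((continuousOn_const.mul (ContinuousOn.rpow_const (ContinuousOn.div (by fun_prop)
      (by fun_prop) fun y hy => ?_) fun y hy => Or.inl ?_)).mul (ContinuousOn.rpow_const
      (ContinuousOn.div (by fun_prop) (by fun_prop) fun y hy => ?_) fun y hy => Or.inl ?_)).mul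
      (hf.mono hpos).norm
    all_goals have := hpos y hy
    all_goals first | positivity | (rw [Pi.div_apply]; positivity)
  have hi : IntegrableOn (fun y => (y - x) ^ (2 * α - 1)) (Icc x b) := by
    rcases le_or_gt x b with hxb | hxb
    · rw [integrableOn_Icc_iff_integrableOn_Ioc, ← intervalIntegrable_iff_integrableOn_Ioc_of_le hxb]
      have := (intervalIntegral.intervalIntegrable_rpow' (a := 0) (b := b - x)
        (by linarith : -1 < 2 * α - 1)).comp_sub_right x
      simpa using this
    · simp [Icc_eq_empty hxb.not_ge]
  refine Integrable.mono' ((hi.mul_continuousOn hc isCompact_Icc).mono_set Ioc_subset_Icc_self) ?_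
    ((ae_restrict_iff' measurableSet_Ioc).2 (ae_of_all _ fun y hy => ?_))
  · exact ((hK.smul (hf.mono fun y hy => hx.trans hy)).mono fun y hy => hy.1).aestronglyMeasurable
      measurableSet_Ioc
  · have hy0 := hx.trans hy.1
    have h := hC x y hx hy.1
    rw [show (y ^ 2 - x ^ 2) / (2 * y) = (y - x) * ((y + x) / (2 * y)) by ring,
      Real.mul_rpow (by linarith [hy.1]) (by positivity)] at h
    rw [norm_smul, Real.norm_eq_abs]
    calc _ ≤ _ := mul_le_mul_of_nonneg_right h (norm_nonneg _)
      _ = _ := by ring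

theorem integrableOn_besselKernel_smul_Ioi_two_mul {ν α x : ℝ} (hν : 0 ≤ ν) (hα : 0 < α)
    (hx : 0 < x) {f : ℝ → 𝕜} (hf : ContinuousOn f (Ioi 0))
    (hfi : IntegrableOn (fun y => y ^ (2 * α + ν) • f y) (Ioi 0)) :
    IntegrableOn (fun y => besselKernel ν α x y • f y) (Ioi (2 * x)) := by
  obtain ⟨C, hC0, hC⟩ := exists_abs_besselKernel_le hν hα
  have hK : ContinuousOn (fun y => besselKernel ν α x y) (Ioi x) :=
    (continuousOn_besselKernel (ν := ν) hα).comp (f := fun y => (x, y)) (by fun_prop)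
      fun y hy => ⟨hx, hy⟩
  have hsub : Ioi (2 * x) ⊆ Ioi x := Ioi_subset_Ioi (by linarith)
  set D := C * (1 + (3 / 8 : ℝ) ^ (2 * α - 1)) * x ^ (-(ν + 1)) with hD
  refine Integrable.mono' (IntegrableOn.mono_set (hfi.norm.const_mul D) (Ioi_subset_Ioi (by linarith))) ?_
    ((ae_restrict_iff' measurableSet_Ioi).2 (ae_of_all _ fun y hy => ?_))
  · exact ((hK.smul (hf.mono fun y hy => hx.trans hy)).mono hsub).aestronglyMeasurable
      measurableSet_Ioi
  · have hxy : x < y := hsub hy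
    have h2 : 2 * x < y := hy
    have hy0 := hx.trans hxy
    -- For `y > 2x` one has `x² / y² ≤ 1/4`, so `s` lies in `[3/8, 1]` and its power is bounded
    -- whatever the sign of `2α - 1`.
    set s := (1 - x ^ 2 / y ^ 2) / 2 with hs
    have hs1 : s ≤ 1 := by
      have := one_sub_sq_div_sq_mem_Ioo hx hxy
      rw [hs]; linarith [this.2]
    have hs2 : 3 / 8 ≤ s := by
      have : x ^ 2 / y ^ 2 ≤ 1 / 4 := by
        rw [div_le_iff₀ (by positivity)]
        nlinarith
      rw [hs]; linarith
    have hs3 : s ^ (2 * α - 1) ≤ 1 + (3 / 8 : ℝ) ^ (2 * α - 1) := by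
      rcases le_total 0 (2 * α - 1) with h | h
      · have := Real.rpow_le_one (by linarith) hs1 h
        have : 0 ≤ (3 / 8 : ℝ) ^ (2 * α - 1) := by positivity
        linarith
      · have := Real.rpow_le_rpow_of_nonpos (by norm_num) hs2 h
        linarith
    have e1 : (x ^ 2 / y ^ 2) ^ (-((ν + 1) / 2)) = x ^ (-(ν + 1)) * y ^ (ν + 1) := by
      rw [Real.div_rpow (by positivity) (by positivity), ← Real.rpow_natCast x,
        ← Real.rpow_natCast y, ← Real.rpow_mul hx.le, ← Real.rpow_mul hy0.le,
        show ((2 : ℕ) : ℝ) * -((ν + 1) / 2) = -(ν + 1) by push_cast; ring,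
        Real.rpow_neg hy0.le, div_inv_eq_mul]
    have e2 : y ^ (2 * α + ν) = y ^ (2 * α - 1) * y ^ (ν + 1) := by
      rw [← Real.rpow_add hy0]; ring_nf
    have h := hC x y hx hxy
    rw [show (y ^ 2 - x ^ 2) / (2 * y) = y * s by rw [hs]; field_simp,
      Real.mul_rpow hy0.le (by linarith), e1] at h
    rw [norm_smul, norm_smul, Real.norm_eq_abs, Real.norm_of_nonneg (Real.rpow_nonneg hy0.le _), e2,
      ← mul_assoc]
    refine mul_le_mul_of_nonneg_right (h.trans ?_) (norm_nonneg _)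
    calc _ ≤ C * (y ^ (2 * α - 1) * (1 + (3 / 8 : ℝ) ^ (2 * α - 1))) *
          (x ^ (-(ν + 1)) * y ^ (ν + 1)) := by gcongr
      _ = _ := by rw [hD]; ring

end

theorem mainTheorem4 {𝕜 : Type*} [RCLike 𝕜] (ν α : ℝ) (hν : 0 ≤ ν) (hα : 0 < α) (f : ℝ → 𝕜) :
    (∀ ξ : ℝ, 0 < ξ → HankelBesselConverges ν α ξ f →
      (∀ᵐ x ∂(volume.restrict (Ioi (0 : ℝ))),
        IntegrableOn (fun y => besselKernel ν α x y • f y) (Ioi x)) ∧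
      IntegrableOn (fun x => hankelKernel ν ξ x • fracBesselMinus ν α f x) (Ioi 0) ∧
      IntegrableOn (fun x => wrightKernel ν α ξ x • f x) (Ioi 0) ∧
      hankelTransform ν (fracBesselMinus ν α f) ξ =
        ξ ^ (-2 * α) • wrightTransform ν α f ξ) ∧
    (IntegrableOn (fun y => y ^ (2 * α + ν) • f y) (Ioi 0) →
      (∀ ξ : ℝ, 0 < ξ → HankelBesselConverges ν α ξ f ∧
        hankelTransform ν (fracBesselMinus ν α f) ξ =
          ξ ^ (-2 * α) • wrightTransform ν α f ξ) ∧
      (ContinuousOn f (Ioi 0) →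
        ∀ x : ℝ, 0 < x → IntegrableOn (fun y => besselKernel ν α x y • f y) (Ioi x))) := by
  refine ⟨fun ξ hξ h => hankelTransform_fracBesselMinus hν hα hξ h, fun hf => ⟨fun ξ hξ => ?_,
    fun hc x hx => ?_⟩⟩
  · have h := hankelBesselConverges_of_integrableOn hν hα hξ hf
    exact ⟨h, (hankelTransform_fracBesselMinus hν hα hξ h).2.2.2⟩
  -- The cut at `2x` separates the singularity at `y = x` from the tail, where the weighted
  -- integrability of `f` is used.
  · rw [← Ioc_union_Ioi_eq_Ioi (by linarith : x ≤ 2 * x)]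
    exact (integrableOn_besselKernel_smul_Ioc hν hα hx hc).union
      (integrableOn_besselKernel_smul_Ioi_two_mul hν hα hx hc hf)
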